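/- For permutations $q \in S_k$ and $p = p_1 \cdots p_n \in S_n$ (in one-line notation), an occurrence of the pattern $q$ in $p$ is a sequence of indices $i_1 < \cdots < i_k$ such that $p_{i_1}, \ldots, p_{i_k}$ are in the same relative order as $q_1, \ldots, q_k$. Let $\mathrm{Av}_n(123)$ be the set of all $p \in S_n$ with no occurrence of $123$, let $f_q$ denote the total number of occurrences of $q$ in all the permutations in $\mathrm{Av}_n(123)$, and let $c_n = \frac{1}{n+1}\binom{2n}{n}$ be the $n$th Catalan number. Put $a_n = f_{132}$, $b_n = f_{231}$ and $d_n = f_{321}$. Then, for every $n \ge 0$, $a_n = f_{213}$, $b_n = f_{312}$ and $$2a_n + 2b_n + d_n = \binom{n}{3} c_n,$$ and, for every $n \ge 1$, $$4a_n + 2b_n = (n-2)\left(4^{n-1} - \binom{2n-1}{n}\right).$$ -/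

import Mathlib

namespace PermPattern

/-- The index sequence `f` (strictly increasing) is an occurrence of the pattern `q` in the
permutation `p`: the entries of `p` at these indices are in the same relative order as those of
`q`. Permutations are read in one-line notation, with positions and values shifted to start
at `0`. -/
def IsOccurrence {k n : ℕ} (q : Equiv.Perm (Fin k)) (p : Equiv.Perm (Fin n))
    (f : Fin k → Fin n) : Prop :=
  (∀ i j, i < j → f i < f j) ∧ ∀ i j, q i < q j ↔ p (f i) < p (f j)

instance {k n : ℕ} (q : Equiv.Perm (Fin k)) (p : Equiv.Perm (Fin n)) :
    DecidablePred (IsOccurrence q p) := fun f => by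
  unfold IsOccurrence
  infer_instance

/-- `p` contains the pattern `q`. -/
def Contains {k n : ℕ} (q : Equiv.Perm (Fin k)) (p : Equiv.Perm (Fin n)) : Prop :=
  ∃ f, IsOccurrence q p f

instance {k n : ℕ} (q : Equiv.Perm (Fin k)) :
    DecidablePred fun p : Equiv.Perm (Fin n) => Contains q p := fun p => by
  unfold Contains
  infer_instance

/-- The set `Av_n(q)` of permutations of length `n` that avoid `q`. -/
def Av (n : ℕ) {k : ℕ} (q : Equiv.Perm (Fin k)) : Finset (Equiv.Perm (Fin n)) :=
  Finset.univ.filter fun p => ¬ Contains q p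

/-- The number of occurrences of the pattern `q` in the permutation `p`. -/
def num {k n : ℕ} (q : Equiv.Perm (Fin k)) (p : Equiv.Perm (Fin n)) : ℕ :=
  (Finset.univ.filter fun f : Fin k → Fin n => IsOccurrence q p f).card

/-- The total number of occurrences of the pattern `q` in the permutations in `C`. -/
def totalNum {k n : ℕ} (q : Equiv.Perm (Fin k)) (C : Finset (Equiv.Perm (Fin n))) : ℕ :=
  ∑ p ∈ C, num q p

/-- The pattern 123. -/
def p123 : Equiv.Perm (Fin 3) := ⟨![0, 1, 2], ![0, 1, 2], by decide, by decide⟩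

/-- The pattern 132. -/
def p132 : Equiv.Perm (Fin 3) := ⟨![0, 2, 1], ![0, 2, 1], by decide, by decide⟩

/-- The pattern 213. -/
def p213 : Equiv.Perm (Fin 3) := ⟨![1, 0, 2], ![1, 0, 2], by decide, by decide⟩

/-- The pattern 231. -/
def p231 : Equiv.Perm (Fin 3) := ⟨![1, 2, 0], ![2, 0, 1], by decide, by decide⟩

/-- The pattern 312. -/
def p312 : Equiv.Perm (Fin 3) := ⟨![2, 0, 1], ![1, 2, 0], by decide, by decide⟩

/-- The pattern 321. -/
def p321 : Equiv.Perm (Fin 3) := ⟨![2, 1, 0], ![2, 1, 0], by decide, by decide⟩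

end PermPattern

/-!
Grouping the triples of positions of a permutation by the pattern found there gives the first
identity. Grouping instead the pairs of a noninversion and a triple of positions containing it
turns the second one into a count of noninversions. The equalities come from the reverse
complement, which fixes 123.

Noninversions are counted with the generating tree of the 123-avoiding permutations, in which a
new maximum is inserted. It may be inserted anywhere up to the end of the initial decreasing run,
and its position determines the number of noninversions created and the new initial run. This
gives recursions for the number of descendants and for the total number of noninversions which
have closed forms: ballot numbers and partial sums of a row of Pascal's triangle.
-/

namespace PermPattern

open Finset

variable {k n : ℕ}

theorem IsOccurrence.strictMono {q : Equiv.Perm (Fin k)} {p : Equiv.Perm (Fin n)}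
    {f : Fin k → Fin n} (hf : IsOccurrence q p f) : StrictMono f :=
  fun i j => hf.1 i j

theorem isOccurrence_iff_strictMono {q : Equiv.Perm (Fin k)} {p : Equiv.Perm (Fin n)}
    {f : Fin k → Fin n} :
    IsOccurrence q p f ↔ StrictMono f ∧ StrictMono (p ∘ f ∘ q.symm) := by
  refine and_congr_right fun _ => ⟨fun h i j hij => ?_, fun h i j => ?_⟩
  · simpa [← h] using hij
  · simpa using (h.lt_iff_lt (a := q i) (b := q j)).symm

theorem isOccurrence_one_iff {p : Equiv.Perm (Fin n)} {f : Fin k → Fin n} :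
    IsOccurrence 1 p f ↔ StrictMono f ∧ StrictMono (p ∘ f) :=
  isOccurrence_iff_strictMono

theorem existsUnique_isOccurrence (p : Equiv.Perm (Fin n)) {f : Fin k → Fin n}
    (hf : StrictMono f) : ∃! q, IsOccurrence q p f := by
  have hpf : Function.Injective (p ∘ f) := p.injective.comp hf.injective
  simp only [isOccurrence_iff_strictMono, hf, true_and]
  refine ⟨(Tuple.sort (p ∘ f)).symm, ?_, fun q hq => ?_⟩
  · exact (Tuple.monotone_sort (p ∘ f)).strictMono_of_injective (hpf.comp (Equiv.injective _))
  · have h := Tuple.unique_monotone (f := p ∘ f) hq.monotone (Tuple.monotone_sort (p ∘ f))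
    rw [← Equiv.symm_symm q, show q.symm = Tuple.sort (p ∘ f) from
      Equiv.ext fun i => hpf (congrFun h i)]

theorem IsOccurrence.comp_iff {j : ℕ} {s : Equiv.Perm (Fin j)} {q : Equiv.Perm (Fin k)}
    {p : Equiv.Perm (Fin n)} {f : Fin k → Fin n} (hf : IsOccurrence q p f) {h : Fin j → Fin k} :
    IsOccurrence s p (f ∘ h) ↔ IsOccurrence s q h := by
  simp only [IsOccurrence, Function.comp_apply, hf.strictMono.lt_iff_lt, hf.2]

open Classical in
theorem sum_sum_isOccurrence {M : Type*} [AddCommMonoid M] (p : Equiv.Perm (Fin n))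
    (F : (Fin k → Fin n) → M) :
    ∑ q, ∑ f with IsOccurrence q p f, F f = ∑ f with StrictMono f, F f := by
  simp only [sum_filter]
  rw [sum_comm]
  refine sum_congr rfl fun f _ => ?_
  split_ifs with hf
  · obtain ⟨q, hq, hunique⟩ := existsUnique_isOccurrence p hf
    rw [Fintype.sum_eq_single q fun q' hq' => if_neg fun h => hq' (hunique q' h), if_pos hq]
  · exact sum_eq_zero fun q _ => if_neg fun h => hf h.strictMono

open Classical in
theorem IsOccurrence.num_eq_card {j : ℕ} (s : Equiv.Perm (Fin j)) {q : Equiv.Perm (Fin k)}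
    {p : Equiv.Perm (Fin n)} {f : Fin k → Fin n} (hf : IsOccurrence q p f) :
    num s q = #{g | IsOccurrence s p g ∧ Set.range g ⊆ Set.range f} := by
  refine card_nbij (f ∘ ·) (fun h hh => ?_) hf.strictMono.injective.comp_left.injOn
    fun g hg => ?_
  · have hh : IsOccurrence s q h := by simpa using hh
    simpa [hf.comp_iff, hh] using Set.range_comp_subset_range h f
  · obtain ⟨hg, hgf⟩ : IsOccurrence s p g ∧ Set.range g ⊆ Set.range f := by simpa using hg
    obtain ⟨h, rfl⟩ := (Set.range_subset_range_iff_exists_comp).1 hgf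
    exact ⟨h, by simpa using hf.comp_iff.1 hg, rfl⟩

open Classical in
theorem card_strictMono_subset_range {α : Type*} [LinearOrder α] [Fintype α] {s : Finset α}
    (hs : #s ≤ k) :
    #{f : Fin k → α | StrictMono f ∧ ↑s ⊆ Set.range f} =
      (Fintype.card α - #s).choose (k - #s) := by
  rw [← card_univ, ← card_filter_powersetCard_subset s univ k (subset_univ s) hs]
  refine card_nbij (univ.image ·) (fun f hf => ?_) (fun f hf f' hf' h => ?_) fun t ht => ?_
  · obtain ⟨hf, hsf⟩ : StrictMono f ∧ ↑s ⊆ Set.range f := by simpa using hf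
    exact mem_filter.2 ⟨mem_powersetCard_univ.2 (by simp [card_image_of_injective _ hf.injective]),
      coe_subset.1 (by simpa using hsf)⟩
  · obtain ⟨hf, -⟩ : StrictMono f ∧ ↑s ⊆ Set.range f := by simpa using hf
    obtain ⟨hf', -⟩ : StrictMono f' ∧ ↑s ⊆ Set.range f' := by simpa using hf'
    exact (hf.range_inj hf').1 (by simpa [← coe_inj] using h)
  · obtain ⟨ht, hst⟩ : #t = k ∧ s ⊆ t := by simpa using ht
    exact ⟨t.orderEmbOfFin ht, by simpa using ⟨(t.orderEmbOfFin ht).strictMono, hst⟩, by simp⟩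

/-- Both sides count the pairs of an occurrence `g` of `s` in `p` and a set of `k` positions
containing those of `g`; the left-hand side groups them by the pattern at the `k` positions. -/
theorem sum_num_mul_num {j : ℕ} (hjk : j ≤ k) (s : Equiv.Perm (Fin j)) (p : Equiv.Perm (Fin n)) :
    ∑ q : Equiv.Perm (Fin k), num s q * num q p = (n - j).choose (k - j) * num s p := by
  classical
  calc ∑ q : Equiv.Perm (Fin k), num s q * num q p
    _ = ∑ q : Equiv.Perm (Fin k), ∑ f with IsOccurrence q p f,
          #{g | IsOccurrence s p g ∧ Set.range g ⊆ Set.range f} := by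
      refine sum_congr rfl fun q _ => ?_
      rw [← sum_congr rfl fun f hf => (mem_filter.1 hf).2.num_eq_card s, sum_const, smul_eq_mul,
        mul_comm, num]
    _ = ∑ f : Fin k → Fin n with StrictMono f,
          #{g | IsOccurrence s p g ∧ Set.range g ⊆ Set.range f} :=
      sum_sum_isOccurrence p _
    _ = ∑ g with IsOccurrence s p g,
          #{f : Fin k → Fin n | StrictMono f ∧ Set.range g ⊆ Set.range f} := by
      simp only [← filter_filter]
      exact sum_card_bipartiteAbove_eq_sum_card_bipartiteBelow _
    _ = ∑ g with IsOccurrence s p g, (n - j).choose (k - j) := by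
      refine sum_congr rfl fun g hg => ?_
      have hcard : #(univ.image g) = j := by
        simp [card_image_of_injective _ (mem_filter.1 hg).2.strictMono.injective]
      simpa [hcard] using card_strictMono_subset_range (k := k) (hcard.trans_le hjk)
    _ = (n - j).choose (k - j) * num s p := by
      rw [sum_const, smul_eq_mul, mul_comm, num]

theorem sum_num_mul_totalNum {j : ℕ} (hjk : j ≤ k) (s : Equiv.Perm (Fin j))
    (C : Finset (Equiv.Perm (Fin n))) :
    ∑ q : Equiv.Perm (Fin k), num s q * totalNum q C =
      (n - j).choose (k - j) * totalNum s C := by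
  simp only [totalNum, mul_sum]
  rw [sum_comm]
  exact sum_congr rfl fun p _ => sum_num_mul_num hjk s p

theorem num_of_isEmpty (s : Equiv.Perm (Fin 0)) (p : Equiv.Perm (Fin n)) : num s p = 1 := by
  simp [num, IsOccurrence]

theorem sum_totalNum (C : Finset (Equiv.Perm (Fin n))) :
    ∑ q : Equiv.Perm (Fin k), totalNum q C = n.choose k * #C := by
  simpa [num_of_isEmpty, totalNum] using sum_num_mul_totalNum k.zero_le 1 C

theorem totalNum_Av_self (q : Equiv.Perm (Fin k)) : totalNum q (Av n q) = 0 := by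
  refine sum_eq_zero fun p hp => card_eq_zero.2 (filter_eq_empty_iff.2 fun f _ hf => ?_)
  exact (mem_filter.1 hp).2 ⟨f, hf⟩

theorem sum_perm_fin_three {M : Type*} [AddCommMonoid M] (F : Equiv.Perm (Fin 3) → M) :
    ∑ q, F q = F p123 + (F p132 + (F p213 + (F p231 + (F p312 + F p321)))) := by
  have huniv : (univ : Finset (Equiv.Perm (Fin 3))) = {p123, p132, p213, p231, p312, p321} := by
    decide
  rw [huniv, sum_insert (by decide), sum_insert (by decide), sum_insert (by decide),
    sum_insert (by decide), sum_insert (by decide), sum_singleton]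

/-- The reverse complement of a permutation, as a bijection of the permutations of length `n`. -/
def revCompl : Equiv.Perm (Equiv.Perm (Fin n)) :=
  Fin.revPerm.permCongr

theorem isOccurrence_revCompl_iff {q : Equiv.Perm (Fin k)} {p : Equiv.Perm (Fin n)}
    {f : Fin k → Fin n} :
    IsOccurrence (revCompl q) (revCompl p) (Fin.revPerm.arrowCongr Fin.revPerm f) ↔
      IsOccurrence q p f := by
  simp only [IsOccurrence, revCompl, Equiv.permCongr_apply, Equiv.arrowCongr_apply,
    Function.comp_apply, Fin.revPerm_symm, Fin.revPerm_apply, Fin.rev_rev, Fin.rev_lt_rev]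
  refine and_congr ⟨fun h i j hij => ?_, fun h i j hij => h _ _ (Fin.rev_lt_rev.2 hij)⟩
    ⟨fun h i j => ?_, fun h i j => h _ _⟩
  · simpa only [Fin.rev_rev] using h j.rev i.rev (Fin.rev_lt_rev.2 hij)
  · simpa only [Fin.rev_rev] using h j.rev i.rev

theorem num_revCompl (q : Equiv.Perm (Fin k)) (p : Equiv.Perm (Fin n)) :
    num (revCompl q) (revCompl p) = num q p :=
  (card_equiv (Fin.revPerm.arrowCongr Fin.revPerm) fun f => by
    simp only [mem_filter, mem_univ, true_and, isOccurrence_revCompl_iff]).symm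

theorem contains_revCompl_iff {q : Equiv.Perm (Fin k)} {p : Equiv.Perm (Fin n)} :
    Contains (revCompl q) (revCompl p) ↔ Contains q p := by
  unfold Contains
  rw [← (Fin.revPerm.arrowCongr Fin.revPerm).exists_congr_right]
  simp only [isOccurrence_revCompl_iff]

theorem totalNum_revCompl {j : ℕ} (q : Equiv.Perm (Fin k)) (s : Equiv.Perm (Fin j)) :
    totalNum (revCompl q) (Av n (revCompl s)) = totalNum q (Av n s) :=
  (sum_equiv revCompl (fun p => by simp [Av, contains_revCompl_iff])
    fun p _ => (num_revCompl q p).symm).symm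

theorem revCompl_p123 : revCompl p123 = p123 := by decide

theorem revCompl_p132 : revCompl p132 = p213 := by decide

theorem revCompl_p231 : revCompl p231 = p312 := by decide

/-- The pattern 12, whose occurrences in a permutation are its noninversions. -/
def p12 : Equiv.Perm (Fin 2) := 1

theorem num_p12 (p : Equiv.Perm (Fin n)) :
    num p12 p = ∑ i, ∑ j, if i < j ∧ p i < p j then 1 else 0 := by
  rw [num, card_filter, ← (finTwoArrowEquiv (Fin n)).symm.sum_comp, Fintype.sum_prod_type]
  simp [p12, isOccurrence_one_iff, Fin.strictMono_iff_lt_succ]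

theorem contains_p123_iff {p : Equiv.Perm (Fin n)} :
    Contains p123 p ↔ ∃ i j l, (i < j ∧ j < l) ∧ p i < p j ∧ p j < p l := by
  have hp123 : p123 = 1 := by decide
  simp only [Contains, hp123, isOccurrence_one_iff, Fin.strictMono_iff_lt_succ, Fin.forall_fin_two]
  exact ⟨fun ⟨f, hf⟩ => ⟨f 0, f 1, f 2, hf⟩, fun ⟨i, j, l, h⟩ => ⟨![i, j, l], h⟩⟩

/-- The permutation obtained from `p` by inserting a new maximal entry at position `j`. -/
def insertMax (j : Fin (n + 1)) (p : Equiv.Perm (Fin n)) : Equiv.Perm (Fin (n + 1)) :=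
  (finSuccEquiv' j).trans (p.optionCongr.trans finSuccEquivLast.symm)

@[simp]
theorem insertMax_self (j : Fin (n + 1)) (p : Equiv.Perm (Fin n)) :
    insertMax j p j = Fin.last n := by
  simp [insertMax]

@[simp]
theorem insertMax_succAbove (j : Fin (n + 1)) (p : Equiv.Perm (Fin n)) (i : Fin n) :
    insertMax j p (j.succAbove i) = (p i).castSucc := by
  simp [insertMax]

theorem insertMax_bijective :
    Function.Bijective fun x : Equiv.Perm (Fin n) × Fin (n + 1) => insertMax x.2 x.1 := by
  rw [Fintype.bijective_iff_injective_and_card]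
  refine ⟨?_, by simp [Fintype.card_perm, Nat.factorial_succ, mul_comm]⟩
  rintro ⟨p, j⟩ ⟨p', j'⟩ (h : insertMax j p = insertMax j' p')
  obtain rfl : j = j' := (insertMax j p).injective (by rw [insertMax_self, h, insertMax_self])
  have hp : p = p' := Equiv.ext fun i => by simpa using Equiv.congr_fun h (j.succAbove i)
  rw [hp]

theorem num_p12_insertMax (j : Fin (n + 1)) (p : Equiv.Perm (Fin n)) :
    num p12 (insertMax j p) = num p12 p + j := by
  have hcount : (∑ i : Fin n, if i.castSucc < j then 1 else 0) = (j : ℕ) := by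
    simp [Fin.lt_def, Fin.card_filter_val_lt, Nat.le_of_lt_succ j.2]
  simp [num_p12, Fin.sum_univ_succAbove _ j, (Fin.le_last _).not_gt,
    Fin.succAbove_lt_iff_castSucc_lt, Fin.castSucc_lt_last, sum_add_distrib, hcount, add_comm]

/-- The length of the initial decreasing run of `p`. -/
def initialRun (p : Equiv.Perm (Fin n)) : ℕ :=
  Nat.findGreatest (fun m => ∀ a b : Fin n, a < b → (b : ℕ) < m → p b < p a) n

theorem initialRun_le (p : Equiv.Perm (Fin n)) : initialRun p ≤ n :=
  Nat.findGreatest_le n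

theorem le_initialRun_iff {p : Equiv.Perm (Fin n)} {m : ℕ} :
    m ≤ initialRun p ↔ m ≤ n ∧ ∀ a b : Fin n, a < b → (b : ℕ) < m → p b < p a := by
  refine ⟨fun h => ⟨h.trans (initialRun_le p), fun a b hab hb => ?_⟩,
    fun h => Nat.le_findGreatest h.1 h.2⟩
  exact Nat.findGreatest_spec (P := fun m => ∀ a b : Fin n, a < b → (b : ℕ) < m → p b < p a)
    n.zero_le (fun _ b _ hb => absurd hb b.val.not_lt_zero) a b hab (hb.trans_le h)

theorem contains_p123_insertMax_iff {j : Fin (n + 1)} {p : Equiv.Perm (Fin n)} :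
    Contains p123 (insertMax j p) ↔
      (∃ a b, (a < b ∧ b.castSucc < j) ∧ p a < p b) ∨ Contains p123 p := by
  simp [contains_p123_iff, Fin.exists_iff_succAbove j, (Fin.le_last _).not_gt,
    Fin.succAbove_lt_iff_castSucc_lt, Fin.castSucc_lt_last, exists_or]

theorem insertMax_mem_Av_iff {j : Fin (n + 1)} {p : Equiv.Perm (Fin n)} :
    insertMax j p ∈ Av (n + 1) p123 ↔ p ∈ Av n p123 ∧ (j : ℕ) ≤ initialRun p := by
  have hrun : (j : ℕ) ≤ initialRun p ↔ ¬ ∃ a b, (a < b ∧ b.castSucc < j) ∧ p a < p b := by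
    rw [le_initialRun_iff, and_iff_right (Nat.le_of_lt_succ j.2)]
    push Not
    refine ⟨fun h a b hab => (h a b hab.1 hab.2).le, fun h a b hab hb => ?_⟩
    exact (h a b ⟨hab, hb⟩).lt_of_ne (p.injective.ne hab.ne')
  simp only [Av, mem_filter, mem_univ, true_and, contains_p123_insertMax_iff, not_or, hrun,
    and_comm]

theorem initialRun_insertMax_zero (p : Equiv.Perm (Fin n)) :
    initialRun (insertMax 0 p) = initialRun p + 1 := by
  have hsucc (i : Fin n) : insertMax 0 p i.succ = (p i).castSucc := insertMax_succAbove 0 p i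
  refine eq_of_forall_le_iff fun m => ?_
  cases m with
  | zero => simp
  | succ m =>
    rw [Nat.add_le_add_iff_right, le_initialRun_iff, le_initialRun_iff]
    simp [Fin.forall_fin_succ, hsucc, Fin.castSucc_lt_last]

theorem initialRun_insertMax_of_ne_zero {j : Fin (n + 1)} {p : Equiv.Perm (Fin n)} (hj : j ≠ 0)
    (hjp : (j : ℕ) ≤ initialRun p) : initialRun (insertMax j p) = j := by
  refine eq_of_forall_le_iff fun m => le_initialRun_iff.trans ⟨fun ⟨_, hm⟩ => ?_, fun hm =>
    ⟨hm.trans j.is_lt.le, fun a b hab hb => ?_⟩⟩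
  · by_contra! hjm
    have hlt := hm 0 j (Fin.pos_iff_ne_zero.2 hj) hjm
    rw [insertMax_self] at hlt
    exact (Fin.le_last _).not_gt hlt
  · have hbj : b < j := hb.trans_le hm
    obtain ⟨a, rfl⟩ := Fin.exists_succAbove_eq (hab.trans hbj).ne
    obtain ⟨b, rfl⟩ := Fin.exists_succAbove_eq hbj.ne
    simpa using (le_initialRun_iff.1 hjp).2 a b (Fin.succAbove_lt_succAbove_iff.1 hab)
      ((Fin.succAbove_lt_iff_castSucc_lt _ _).1 hbj)

theorem initialRun_insertMax {j : Fin (n + 1)} {p : Equiv.Perm (Fin n)}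
    (hjp : (j : ℕ) ≤ initialRun p) :
    initialRun (insertMax j p) = if (j : ℕ) = 0 then initialRun p + 1 else j := by
  rcases eq_or_ne j 0 with rfl | hj
  · simp [initialRun_insertMax_zero]
  · rw [initialRun_insertMax_of_ne_zero hj hjp, if_neg (Fin.val_ne_zero_iff.2 hj)]

theorem sum_Av_succ {M : Type*} [AddCommMonoid M] (F : Equiv.Perm (Fin (n + 1)) → M) :
    ∑ p ∈ Av (n + 1) p123, F p =
      ∑ p ∈ Av n p123, ∑ j : Fin (n + 1) with j.val ≤ initialRun p, F (insertMax j p) := by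
  rw [← Fintype.sum_ite_mem, ← (Equiv.ofBijective _ insertMax_bijective).sum_comp,
    Fintype.sum_prod_type, ← Fintype.sum_ite_mem]
  simp [insertMax_mem_Av_iff, ite_and, sum_filter]

theorem sum_fin_filter_le {M : Type*} [AddCommMonoid M] {m : ℕ} (hm : m ≤ n) (F : ℕ → M) :
    ∑ j : Fin (n + 1) with j.val ≤ m, F j = ∑ j ∈ range (m + 1), F j := by
  rw [sum_filter, Fin.sum_univ_eq_sum_range (fun j => if j ≤ m then F j else 0), ← sum_filter]
  exact sum_congr (by grind) fun _ _ => rfl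

/-- Inserting the new maximum at the front lengthens the initial run by one; inserting it at
position `j + 1`, within or right after the initial run, cuts the run down to `j + 1` and creates
`j + 1` noninversions. -/
theorem sum_Av_succ_initialRun_num_p12 {M : Type*} [AddCommMonoid M] (n : ℕ) (F : ℕ → ℕ → M) :
    ∑ p ∈ Av (n + 1) p123, F (initialRun p) (num p12 p) =
      ∑ p ∈ Av n p123, (F (initialRun p + 1) (num p12 p) +
        ∑ j ∈ range (initialRun p), F (j + 1) (num p12 p + (j + 1))) := by
  rw [sum_Av_succ]
  refine sum_congr rfl fun p _ => ?_
  calc ∑ j : Fin (n + 1) with j.val ≤ initialRun p,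
        F (initialRun (insertMax j p)) (num p12 (insertMax j p))
    _ = ∑ j : Fin (n + 1) with j.val ≤ initialRun p,
          F (if j.val = 0 then initialRun p + 1 else j) (num p12 p + j) :=
      sum_congr rfl fun j hj => by
        rw [initialRun_insertMax (mem_filter.1 hj).2, num_p12_insertMax]
    _ = ∑ j ∈ range (initialRun p + 1),
          F (if j = 0 then initialRun p + 1 else j) (num p12 p + j) :=
      sum_fin_filter_le (initialRun_le p) fun j =>
        F (if j = 0 then initialRun p + 1 else j) (num p12 p + j)
    _ = F (initialRun p + 1) (num p12 p) +
          ∑ j ∈ range (initialRun p), F (j + 1) (num p12 p + (j + 1)) := by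
      rw [sum_range_succ', add_comm]
      simp

/-- The number of descendants after `r` generations of a node labelled `k` in the generating tree
in which a node labelled `k` has children labelled `1, …, k + 1`. -/
def descendants (k : ℕ) : ℕ → ℕ
  | 0 => 1
  | r + 1 => descendants (k + 1) r + ∑ j ∈ range k, descendants (j + 1) r

/-- The total weight of the paths of length `r` from a node labelled `k` in the same generating
tree, where the edge to the child labelled `k + 1` has weight `0` and the edge to a child labelled
`j ≤ k` has weight `j`. -/
def pathWeight (k : ℕ) : ℕ → ℕ
  | 0 => 0
  | r + 1 => pathWeight (k + 1) r +
      ∑ j ∈ range k, (pathWeight (j + 1) r + descendants (j + 1) r * (j + 1))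

theorem totalNum_p12_Av_add (n r : ℕ) : totalNum p12 (Av (n + r) p123) =
    ∑ p ∈ Av n p123, (descendants (initialRun p) r * num p12 p + pathWeight (initialRun p) r) := by
  induction r generalizing n with
  | zero => simp [totalNum, descendants, pathWeight]
  | succ r ih =>
    rw [← add_assoc, add_right_comm, ih,
      sum_Av_succ_initialRun_num_p12 n fun k x => descendants k r * x + pathWeight k r]
    refine sum_congr rfl fun p _ => ?_
    simp only [descendants, pathWeight, mul_add, sum_add_distrib, add_mul, sum_mul]
    ring

theorem card_Av_add (n r : ℕ) :
    #(Av (n + r) p123) = ∑ p ∈ Av n p123, descendants (initialRun p) r := by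
  induction r generalizing n with
  | zero => simp [descendants]
  | succ r ih =>
    rw [← add_assoc, add_right_comm, ih,
      sum_Av_succ_initialRun_num_p12 n fun k _ => descendants k r]
    rfl

theorem descendants_zero_succ (r : ℕ) : descendants 0 (r + 1) = descendants 1 r := by
  simp [descendants]

theorem descendants_succ_succ (k r : ℕ) :
    descendants (k + 1) (r + 1) = descendants k (r + 1) + descendants (k + 2) r := by
  simp only [descendants, sum_range_succ]
  ring

theorem descendants_add_choose (k r : ℕ) :
    descendants k (r + 1) + (2 * r + k + 2).choose r = (2 * r + k + 2).choose (r + 1) := by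
  induction r generalizing k with
  | zero => simp +arith [descendants]
  | succ r ih =>
    induction k with
    | zero =>
      have hsymm : (2 * r + 3).choose (r + 2) = (2 * r + 3).choose (r + 1) :=
        Nat.choose_symm_of_eq_add (by ring)
      have h := ih 1
      rw [descendants_zero_succ, show 2 * (r + 1) + 0 + 2 = 2 * r + 3 + 1 by ring,
        Nat.choose_succ_succ' _ r, Nat.choose_succ_succ' _ (r + 1)]
      linarith
    | succ k ihk =>
      have h := ih (k + 2)
      rw [show 2 * (r + 1) + k + 2 = 2 * r + (k + 2) + 2 by ring] at ihk
      rw [descendants_succ_succ,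
        show 2 * (r + 1) + (k + 1) + 2 = 2 * r + (k + 2) + 2 + 1 by ring,
        Nat.choose_succ_succ' _ r, Nat.choose_succ_succ' _ (r + 1)]
      linarith

theorem descendants_zero_left (n : ℕ) : descendants 0 n = catalan n := by
  cases n with
  | zero => simp [descendants]
  | succ r =>
    have hcatalan := succ_mul_catalan_eq_centralBinom (r + 1)
    have hchoose := Nat.choose_succ_right_eq (2 * r + 2) r
    have hdesc := descendants_add_choose 0 r
    rw [Nat.centralBinom, show 2 * (r + 1) = 2 * r + 2 by ring] at hcatalan
    rw [show 2 * r + 2 - r = r + 2 by omega] at hchoose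
    refine Nat.eq_of_mul_eq_mul_left (Nat.succ_pos (r + 1)) ?_
    rw [add_zero] at hdesc
    nlinarith

theorem pathWeight_zero_succ (r : ℕ) : pathWeight 0 (r + 1) = pathWeight 1 r := by
  simp [pathWeight]

theorem pathWeight_succ_succ (k r : ℕ) :
    pathWeight (k + 1) (r + 1) =
      pathWeight k (r + 1) + pathWeight (k + 2) r + (k + 1) * descendants (k + 1) r := by
  simp only [pathWeight, sum_range_succ]
  ring

theorem sum_range_choose_succ (N m : ℕ) :
    ∑ i ∈ range (m + 1), (N + 1).choose i = 2 * ∑ i ∈ range m, N.choose i + N.choose m := by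
  have hshift := sum_range_succ' N.choose m
  rw [sum_range_succ] at hshift
  simp only [sum_range_succ', Nat.choose_succ_succ', sum_add_distrib, Nat.choose_zero_right]
    at hshift ⊢
  linarith

theorem pathWeight_one (k : ℕ) : pathWeight k 1 = (k + 1).choose 2 := by
  have hgauss : ∑ j ∈ range k, (j + 1) = ∑ j ∈ range (k + 1), j := by simp [sum_range_succ']
  simpa [pathWeight, descendants, sum_range_id, Nat.choose_two_right] using hgauss

theorem pathWeight_eq (k r : ℕ) :
    pathWeight k (r + 1) = (k + 1) * ∑ i ∈ range r, (2 * r + k + 1).choose i +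
      (k + 1).choose 2 * (2 * r + k + 1).choose r := by
  induction r generalizing k with
  | zero => simp [pathWeight_one]
  | succ r ih =>
    induction k with
    | zero =>
      rw [pathWeight_zero_succ, ih, show 2 * (r + 1) + 0 + 1 = 2 * r + 1 + 1 + 1 by ring,
        sum_range_choose_succ (2 * r + 1 + 1)]
      simp
    | succ k ihk =>
      have hdesc := descendants_add_choose (k + 1) r
      have hchoose_add_two := Nat.choose_succ_succ' (k + 1) 1
      have hchoose_add_three := Nat.choose_succ_succ' (k + 2) 1
      rw [Nat.choose_one_right] at hchoose_add_two hchoose_add_three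
      rw [pathWeight_succ_succ, ihk, ih, show 2 * (r + 1) + k + 1 = 2 * r + (k + 1) + 2 by ring,
        show 2 * r + (k + 2) + 1 = 2 * r + (k + 1) + 2 by ring,
        show 2 * (r + 1) + (k + 1) + 1 = 2 * r + (k + 1) + 2 + 1 by ring,
        sum_range_choose_succ (2 * r + (k + 1) + 2), sum_range_succ,
        Nat.choose_succ_succ' (2 * r + (k + 1) + 2) r, hchoose_add_three, hchoose_add_two, ← hdesc]
      ring

theorem Av_zero_p123 : Av 0 p123 = {1} := by decide

theorem card_Av_p123 (n : ℕ) : #(Av n p123) = catalan n := by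
  have hcard := card_Av_add 0 n
  rwa [zero_add, Av_zero_p123, sum_singleton, Nat.le_zero.1 (initialRun_le _),
    descendants_zero_left] at hcard

theorem totalNum_p12_Av_succ (r : ℕ) :
    totalNum p12 (Av (r + 1) p123) + (2 * r + 1).choose (r + 1) = 4 ^ r := by
  have htotal := totalNum_p12_Av_add 0 (r + 1)
  rw [zero_add, Av_zero_p123, sum_singleton, Nat.le_zero.1 (initialRun_le _),
    pathWeight_eq] at htotal
  have hsum : totalNum p12 (Av (r + 1) p123) = ∑ i ∈ range r, (2 * r + 1).choose i := by
    simpa [num_p12] using htotal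
  rw [hsum, ← Nat.sum_range_choose_halfway, sum_range_succ, Nat.choose_symm_half]

theorem totalNum_p213_Av_p123 (n : ℕ) :
    totalNum p213 (Av n p123) = totalNum p132 (Av n p123) := by
  rw [← totalNum_revCompl p132 p123, revCompl_p132, revCompl_p123]

theorem totalNum_p312_Av_p123 (n : ℕ) :
    totalNum p312 (Av n p123) = totalNum p231 (Av n p123) := by
  rw [← totalNum_revCompl p231 p123, revCompl_p231, revCompl_p123]

theorem two_mul_totalNum_p132_add_two_mul_totalNum_p231_add_totalNum_p321 (n : ℕ) :
    2 * totalNum p132 (Av n p123) + 2 * totalNum p231 (Av n p123) + totalNum p321 (Av n p123) =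
      n.choose 3 * catalan n := by
  have hall := sum_totalNum (k := 3) (Av n p123)
  rw [sum_perm_fin_three, totalNum_Av_self, totalNum_p213_Av_p123, totalNum_p312_Av_p123,
    card_Av_p123] at hall
  linarith

theorem four_mul_totalNum_p132_add_two_mul_totalNum_p231 (n : ℕ) :
    4 * totalNum p132 (Av n p123) + 2 * totalNum p231 (Av n p123) =
      (n - 2) * totalNum p12 (Av n p123) := by
  have hnum : num p12 p132 = 2 ∧ num p12 p213 = 2 ∧ num p12 p231 = 1 ∧ num p12 p312 = 1 ∧
      num p12 p321 = 0 := by decide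
  have hpairs := sum_num_mul_totalNum (k := 3) (by norm_num) p12 (Av n p123)
  simp only [sum_perm_fin_three, totalNum_Av_self, totalNum_p213_Av_p123, totalNum_p312_Av_p123,
    hnum, Nat.reduceSub, Nat.choose_one_right] at hpairs
  linarith

theorem four_mul_totalNum_p132_add_two_mul_totalNum_p231_succ (r : ℕ) :
    4 * (totalNum p132 (Av (r + 1) p123) : ℤ) + 2 * (totalNum p231 (Av (r + 1) p123) : ℤ) =
      ((r : ℤ) - 1) * (4 ^ r - ((2 * r + 1).choose (r + 1) : ℤ)) := by
  have hnoninversions := totalNum_p12_Av_succ r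
  have hpairs := four_mul_totalNum_p132_add_two_mul_totalNum_p231 (r + 1)
  zify at hnoninversions hpairs
  rw [hpairs, ← hnoninversions, add_sub_cancel_right]
  cases r with
  | zero => simpa using hnoninversions
  | succ r => simp

end PermPattern

theorem mainTheorem11 (n a b d : ℕ)
    (ha : a = PermPattern.totalNum PermPattern.p132 (PermPattern.Av n PermPattern.p123))
    (hb : b = PermPattern.totalNum PermPattern.p231 (PermPattern.Av n PermPattern.p123))
    (hd : d = PermPattern.totalNum PermPattern.p321 (PermPattern.Av n PermPattern.p123)) :
    a = PermPattern.totalNum PermPattern.p213 (PermPattern.Av n PermPattern.p123) ∧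
    b = PermPattern.totalNum PermPattern.p312 (PermPattern.Av n PermPattern.p123) ∧
    2 * a + 2 * b + d = n.choose 3 * catalan n ∧
    (1 ≤ n →
      4 * (a : ℤ) + 2 * (b : ℤ) =
        ((n : ℤ) - 2) * (4 ^ (n - 1) - ((2 * n - 1).choose n : ℤ))) := by
  subst ha hb hd
  refine ⟨(PermPattern.totalNum_p213_Av_p123 n).symm, (PermPattern.totalNum_p312_Av_p123 n).symm,
    PermPattern.two_mul_totalNum_p132_add_two_mul_totalNum_p231_add_totalNum_p321 n,
    fun hn => ?_⟩
  obtain ⟨r, rfl⟩ := Nat.exists_eq_add_of_le' hn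
  rw [PermPattern.four_mul_totalNum_p132_add_two_mul_totalNum_p231_succ,
    Nat.add_sub_cancel, Nat.mul_add_one, Nat.add_succ_sub_one, Nat.cast_add_one]
  ring
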